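/- Let $\mathbf{CSRng}$ be the category of commutative semirings (with $0$ and $1$) and their homomorphisms. Every monad $(T,\eta,\mu)$ on $\mathbf{Sets}$ has the canonical strength $\mathrm{st}\colon T(X)\times Y\to T(X\times Y)$, $\mathrm{st}(u,y)=T(x\mapsto(x,y))(u)$, with swapped version $\mathrm{st}'=T(\gamma)\circ\mathrm{st}\circ\gamma\colon X\times T(Y)\to T(X\times Y)$, where $\gamma$ denotes the swap maps; $T$ is *commutative* if $\mu\circ T(\mathrm{st}')\circ\mathrm{st}=\mu\circ T(\mathrm{st})\circ\mathrm{st}'$ as maps $T(X)\times T(Y)\to T(X\times Y)$. It is *additive* if $T(0)\cong 1$ and, for all sets $X,Y$, the map $\mathrm{bc}=\langle\mu\circ T(p_1),\mu\circ T(p_2)\rangle\colon T(X+Y)\to T(X)\times T(Y)$ is a bijection, where $p_1=[\eta,0]\colon X+Y\to T(X)$, $p_2=[0,\eta]\colon X+Y\to T(Y)$ and the zero maps $0$ are the composites $X\to 1\cong T(0)\to T(Y)$. Let $\mathbf{ACMnd}$ be the category of commutative additive monads on $\mathbf{Sets}$ with monad maps as morphisms. Let $\mathcal M\colon\mathbf{CSRng}\to\mathbf{ACMnd}$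 be the functor sending $S$ to the multiset monad $M_S$, where $M_S(X)$ is the set of finitely supported functions $X\to S$ (written as formal sums $\sum_i s_ix_i$), $M_S(g)(\sum_i s_ix_i)=\sum_i s_ig(x_i)$, $\eta(x)=1x$ and $\mu(\sum_i s_i\varphi_i)=\big(x\mapsto\sum_i s_i\varphi_i(x)\big)$, and sending a homomorphism $f$ to the monad map $\sum_i s_ix_i\mapsto\sum_i f(s_i)x_i$. Let $\mathcal E\colon\mathbf{ACMnd}\to\mathbf{CSRng}$ be the functor sending $T$ to the set $T(1)$ with addition $T(\nabla)\circ\mathrm{bc}^{-1}$, zero the zero map $1\to T(1)$, multiplication $\mu\circ T(\pi_2)\circ\mathrm{st}$ and unit $\eta_1\colon 1\to T(1)$, and sending a monad map $\sigma$ to its component $\sigma_1$. Then $\mathcal M$ is left adjoint to $\mathcal E$, $\mathcal M\dashv\mathcal E$. Moreover, evaluation at the point, $\varphi\mapsto\varphi(*)$, is an isomorphism of semirings $\mathcal E\mathcal M(S)=M_S(1)\cong S$, natural in $S$, and its inverse $S\to\mathcal E\mathcal M(S)$, which sends $s$ to the function with $*\mapsto s$, is the unit of the adjunction. Hence $\mathcal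 M$ is full and faithful, i.e. the adjunction exhibits $\mathbf{CSRng}$ as a coreflective subcategory of $\mathbf{ACMnd}$. -/

import Mathlib

open CategoryTheory

universe u

namespace SetMonad

/-! ### Kleisli calculus for a monad on the category of sets -/

section Basics

variable (T : Monad (Type u))

/-- The action `T(f) : T(X) → T(Y)` of a monad on a function. -/
def fmap {X Y : Type u} (f : X → Y) (t : T.obj X) : T.obj Y := T.map (↾f) t

/-- The unit `η : X → T(X)`. -/
def unit {X : Type u} (x : X) : T.obj X := T.η.app X x

/-- The multiplication `μ : T(T(X)) → T(X)`. -/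
def mult {X : Type u} (t : T.obj (T.obj X)) : T.obj X := T.μ.app X t

/-- Kleisli extension `μ ∘ T(f) : T(X) → T(Y)` of `f : X → T(Y)`. -/
def ext {X Y : Type u} (f : X → T.obj Y) (t : T.obj X) : T.obj Y := mult T (fmap T f t)

/-- The canonical strength `st : T(X) × Y → T(X × Y)`, `(u, y) ↦ T(x ↦ (x, y))(u)`. -/
def st {X Y : Type u} (p : T.obj X × Y) : T.obj (X × Y) := fmap T (fun x => (x, p.2)) p.1

/-- The swapped strength `st' = T(γ) ∘ st ∘ γ : X × T(Y) → T(X × Y)`. -/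
def st' {X Y : Type u} (p : X × T.obj Y) : T.obj (X × Y) :=
  fmap T Prod.swap (st T p.swap)

/-- A monad on sets is commutative if the two maps
`μ ∘ T(st') ∘ st, μ ∘ T(st) ∘ st' : T(X) × T(Y) → T(X × Y)` coincide. -/
def IsCommutative : Prop :=
  ∀ (X Y : Type u) (p : T.obj X × T.obj Y),
    mult T (fmap T (st' T) (st T p)) = mult T (fmap T (st T) (st' T p))

/-- The condition `T(0) ≅ 1`. -/
def ZeroTerminal : Prop := Nonempty (T.obj PEmpty.{u + 1} ≅ PUnit.{u + 1})

variable {T}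

/-- The zero map `X → 1 ≅ T(0) → T(Y)`. -/
noncomputable def zeroMap (h : ZeroTerminal T) (X Y : Type u) (_ : X) : T.obj Y :=
  fmap T PEmpty.elim (h.some.inv PUnit.unit)

/-- `p₁ = [η, 0] : X + Y → T(X)`. -/
noncomputable def proj₁ (h : ZeroTerminal T) (X Y : Type u) : X ⊕ Y → T.obj X :=
  Sum.elim (unit T) (zeroMap h Y X)

/-- `p₂ = [0, η] : X + Y → T(Y)`. -/
noncomputable def proj₂ (h : ZeroTerminal T) (X Y : Type u) : X ⊕ Y → T.obj Y :=
  Sum.elim (zeroMap h X Y) (unit T)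

/-- The canonical map `bc = ⟨μ ∘ T(p₁), μ ∘ T(p₂)⟩ : T(X + Y) → T(X) × T(Y)`. -/
noncomputable def bc (h : ZeroTerminal T) (X Y : Type u) (t : T.obj (X ⊕ Y)) :
    T.obj X × T.obj Y :=
  (ext T (proj₁ h X Y) t, ext T (proj₂ h X Y) t)

variable (T)

/-- A monad on sets is additive if `T(0) ≅ 1` and all maps `bc` are isomorphisms. -/
structure IsAdditive : Prop where
  zero : ZeroTerminal T
  bc_bijective : ∀ X Y : Type u, Function.Bijective (bc zero X Y)

variable {T}

/-- The addition `T(∇) ∘ bc⁻¹ : T(X) × T(X) → T(X)`. -/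
noncomputable def add (h : IsAdditive T) {X : Type u} (a b : T.obj X) : T.obj X :=
  fmap T (Sum.elim id id) ((Equiv.ofBijective _ (h.bc_bijective X X)).symm (a, b))

/-- The zero element of `T(X)`, i.e. the zero map `1 → T(X)`. -/
noncomputable def zero (h : IsAdditive T) (X : Type u) : T.obj X :=
  zeroMap h.zero PUnit X PUnit.unit

variable (T)

/-- The multiplication `μ ∘ T(π₂) ∘ st : T(1) × T(1) → T(1)`. -/
def mul (a b : T.obj PUnit.{u + 1}) : T.obj PUnit.{u + 1} :=
  mult T (fmap T Prod.snd (st T (a, b)))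

/-! Basic laws. -/

theorem fmap_eq_ext {X Y : Type u} (f : X → Y) (t : T.obj X) :
    fmap T f t = ext T (fun x => unit T (f x)) t := by
  have h1 : mult T (fmap T (unit T) (fmap T f t)) = fmap T f t :=
    ConcreteCategory.congr_hom (T.right_unit Y) _
  have h2 : fmap T (fun x => unit T (f x)) t = fmap T (unit T) (fmap T f t) :=
    ConcreteCategory.congr_hom (T.map_comp (↾f) (T.η.app Y)) t
  rw [ext, h2, h1]

theorem ext_unit {X Y : Type u} (f : X → T.obj Y) (x : X) : ext T f (unit T x) = f x := by
  have h1 := ConcreteCategory.congr_hom (T.left_unit Y) (f x)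
  have h2 := ConcreteCategory.congr_hom (T.η.naturality (↾f)) x
  simp only [types_comp_apply, types_id_apply] at h1 h2
  refine Eq.trans (congrArg (T.μ.app Y) ?_) h1
  exact h2.symm

theorem ext_id {X : Type u} (t : T.obj X) : ext T (unit T) t = t :=
  ConcreteCategory.congr_hom (T.right_unit X) t

theorem fmap_fmap {X Y Z : Type u} (g : Y → Z) (f : X → Y) (t : T.obj X) :
    fmap T g (fmap T f t) = fmap T (fun x => g (f x)) t :=
  (ConcreteCategory.congr_hom (T.map_comp (↾f) (↾g)) t).symm

theorem fmap_mult {X Y : Type u} (f : X → Y) (t : T.obj (T.obj X)) :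
    fmap T f (mult T t) = mult T (fmap T (fmap T f) t) :=
  (ConcreteCategory.congr_hom (T.μ.naturality (↾f)) t).symm

theorem mult_mult {X : Type u} (t : T.obj (T.obj (T.obj X))) :
    mult T (mult T t) = mult T (fmap T (mult T) t) :=
  (ConcreteCategory.congr_hom (T.assoc X) t).symm

theorem ext_ext {X Y Z : Type u} (g : Y → T.obj Z) (f : X → T.obj Y) (t : T.obj X) :
    ext T g (ext T f t) = ext T (fun x => ext T g (f x)) t := by
  unfold ext
  rw [fmap_mult, mult_mult, fmap_fmap, fmap_fmap]

theorem ext_fmap {X Y Z : Type u} (g : Y → T.obj Z) (f : X → Y) (t : T.obj X) :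
    ext T g (fmap T f t) = ext T (fun x => g (f x)) t := by
  unfold ext
  rw [fmap_fmap]

theorem fmap_ext {X Y Z : Type u} (g : Y → Z) (f : X → T.obj Y) (t : T.obj X) :
    fmap T g (ext T f t) = ext T (fun x => fmap T g (f x)) t := by
  unfold ext
  rw [fmap_mult, fmap_fmap]

theorem fmap_unit {X Y : Type u} (f : X → Y) (x : X) :
    fmap T f (unit T x) = unit T (f x) := by
  rw [fmap_eq_ext, ext_unit]

theorem fmap_id {X : Type u} (t : T.obj X) : fmap T (fun x => x) t = t := by
  rw [fmap_eq_ext]; exact ext_id T t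

theorem mul_eq_ext (a b : T.obj PUnit.{u + 1}) : mul T a b = ext T (fun _ => b) a := by
  unfold mul st ext
  rw [fmap_fmap]

theorem isCommutative_iff :
    IsCommutative T ↔ ∀ (X Y : Type u) (a : T.obj X) (b : T.obj Y),
      ext T (fun x => fmap T (fun y => (x, y)) b) a =
        ext T (fun y => fmap T (fun x => (x, y)) a) b := by
  unfold IsCommutative
  refine forall₂_congr fun X Y => ⟨fun h a b => ?_, fun h p => ?_⟩
  · have := h (a, b)
    simpa [st', st, ext, fmap_fmap] using this
  · have := h p.1 p.2
    simpa [st', st, ext, fmap_fmap] using this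

end Basics

/-! ### The commutative semiring `T(1)` -/

section Semiring

variable {T : Monad (Type u)}

theorem zeroTerminal_subsingleton (h : ZeroTerminal T) (a b : T.obj PEmpty.{u + 1}) : a = b := by
  have h1 := h.some.hom_inv_id_apply a
  have h2 := h.some.hom_inv_id_apply b
  rw [← h1, ← h2]

theorem zeroMap_eq (h : ZeroTerminal T) (X Y : Type u) (x : X) (t : T.obj PEmpty.{u + 1}) :
    zeroMap h X Y x = fmap T PEmpty.elim t := by
  unfold zeroMap
  rw [zeroTerminal_subsingleton h t]

theorem zeroMap_eq_zero (h : IsAdditive T) (X Y : Type u) (x : X) :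
    zeroMap h.zero X Y x = zero h Y := rfl

theorem ext_zero (h : IsAdditive T) {X Y : Type u} (f : X → T.obj Y) :
    ext T f (zero h X) = zero h Y := by
  unfold zero zeroMap
  rw [ext_fmap, fmap_eq_ext]
  congr 1
  funext x
  exact x.elim

theorem fmap_zero (h : IsAdditive T) {X Y : Type u} (f : X → Y) :
    fmap T f (zero h X) = zero h Y := by
  rw [fmap_eq_ext, ext_zero]

theorem add_eq (h : IsAdditive T) {X : Type u} {a b : T.obj X} (w : T.obj (X ⊕ X))
    (ha : ext T (Sum.elim (unit T) fun _ => zero h X) w = a)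
    (hb : ext T (Sum.elim (fun _ => zero h X) (unit T)) w = b) :
    add h a b = fmap T (Sum.elim id id) w := by
  unfold add
  congr 1
  rw [Equiv.symm_apply_eq]
  subst ha hb
  rfl

theorem exists_sum (h : IsAdditive T) {X Y : Type u} (a : T.obj X) (b : T.obj Y) :
    ∃ w : T.obj (X ⊕ Y),
      ext T (Sum.elim (unit T) fun _ => zero h X) w = a ∧
        ext T (Sum.elim (fun _ => zero h Y) (unit T)) w = b := by
  obtain ⟨w, hw⟩ := (h.bc_bijective X Y).2 (a, b)
  exact ⟨w, congrArg Prod.fst hw, congrArg Prod.snd hw⟩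

theorem ext_congr {X Y : Type u} {f g : X → T.obj Y} (h : ∀ x, f x = g x) (t : T.obj X) :
    ext T f t = ext T g t := by
  rw [funext h]

theorem add_comm' (h : IsAdditive T) {X : Type u} (a b : T.obj X) : add h a b = add h b a := by
  obtain ⟨w, ha, hb⟩ := exists_sum h a b
  rw [add_eq h w ha hb, add_eq h (fmap T Sum.swap w), fmap_fmap]
  · congr 1
    funext x
    cases x <;> rfl
  · rw [ext_fmap, ← hb]
    refine ext_congr (fun x => ?_) w
    cases x <;> rfl
  · rw [ext_fmap, ← ha]
    refine ext_congr (fun x => ?_) w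
    cases x <;> rfl

theorem ext_zero_fun (h : IsAdditive T) {X Y : Type u} (t : T.obj X) :
    ext T (fun _ => zero h Y) t = zero h Y := by
  have h1 := fmap_ext T (Y := PEmpty.{u + 1}) (Z := Y) PEmpty.elim
    (fun _ : X => h.zero.some.inv PUnit.unit) t
  exact h1.symm.trans (zeroMap_eq h.zero _ _ PUnit.unit _).symm

theorem zero_add' (h : IsAdditive T) {X : Type u} (a : T.obj X) : add h (zero h X) a = a := by
  rw [add_eq h (fmap T Sum.inr a), fmap_fmap]
  · exact fmap_id T a
  · rw [ext_fmap]
    exact ext_zero_fun h a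
  · rw [ext_fmap]
    exact ext_id T a

theorem add_assoc' (h : IsAdditive T) {X : Type u} (a b c : T.obj X) :
    add h (add h a b) c = add h a (add h b c) := by
  obtain ⟨y, hb, hc⟩ := exists_sum h b c
  obtain ⟨z, ha, hy⟩ := exists_sum h a y
  have e1 : add h b c = fmap T (Sum.elim id id) y := add_eq h y hb hc
  have e2 : add h a (add h b c) = fmap T (Sum.elim id (Sum.elim id id)) z := by
    rw [add_eq h (fmap T (Sum.map id (Sum.elim id id)) z), fmap_fmap]
    · congr 1
      funext x
      rcases x with x | x | x <;> rfl
    · rw [ext_fmap, ← ha]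
      refine ext_congr (fun x => ?_) z
      cases x <;> rfl
    · rw [ext_fmap, e1, ← hy, fmap_ext]
      refine ext_congr (fun x => ?_) z
      rcases x with x | x <;> simp [fmap_zero, fmap_unit]
  have e3 : add h a b = ext T (Sum.elim (unit T) (Sum.elim (unit T) fun _ => zero h X)) z := by
    rw [add_eq h (ext T (Sum.elim (fun x => unit T (Sum.inl x))
      (Sum.elim (fun x => unit T (Sum.inr x)) fun _ => zero h (X ⊕ X))) z), fmap_ext]
    · refine ext_congr (fun x => ?_) z
      rcases x with x | x | x <;> simp [fmap_zero, fmap_unit]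
    · rw [ext_ext, ← ha]
      refine ext_congr (fun x => ?_) z
      rcases x with x | x | x <;> simp [ext_zero, ext_unit]
    · rw [ext_ext, ← hb, ← hy, ext_ext]
      refine ext_congr (fun x => ?_) z
      rcases x with x | x | x <;> simp [ext_zero, ext_unit]
  rw [e2, add_eq h (fmap T (Sum.elim Sum.inl (Sum.elim Sum.inl Sum.inr)) z), fmap_fmap]
  · congr 1
    funext x
    rcases x with x | x | x <;> rfl
  · rw [ext_fmap, e3]
    refine ext_congr (fun x => ?_) z
    rcases x with x | x | x <;> rfl
  · rw [ext_fmap, ← hc, ← hy, ext_ext]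
    refine ext_congr (fun x => ?_) z
    rcases x with x | x | x <;> simp [ext_zero, ext_unit]

theorem ext_add (h : IsAdditive T) {X Y : Type u} (f : X → T.obj Y) (a b : T.obj X) :
    ext T f (add h a b) = add h (ext T f a) (ext T f b) := by
  obtain ⟨w, ha, hb⟩ := exists_sum h a b
  rw [add_eq h w ha hb, ext_fmap,
    add_eq h (ext T (Sum.elim (fun x => fmap T Sum.inl (f x)) fun x => fmap T Sum.inr (f x)) w),
    fmap_ext]
  · refine ext_congr (fun x => ?_) w
    rcases x with x | x
    · exact ((fmap_fmap T _ _ _).trans (fmap_id T _)).symm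
    · exact ((fmap_fmap T _ _ _).trans (fmap_id T _)).symm
  · rw [← ha, ext_ext, ext_ext]
    refine ext_congr (fun x => ?_) w
    rcases x with x | x
    · simp only [Sum.elim_inl, ext_fmap, ext_unit]
      exact ext_id T _
    · simp only [Sum.elim_inr, ext_fmap, ext_zero]
      exact ext_zero_fun h _
  · rw [← hb, ext_ext, ext_ext]
    refine ext_congr (fun x => ?_) w
    rcases x with x | x
    · simp only [Sum.elim_inl, ext_fmap, ext_zero]
      exact ext_zero_fun h _
    · simp only [Sum.elim_inr, ext_fmap, ext_unit]
      exact ext_id T _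

theorem mul_comm' (h : IsCommutative T) (a b : T.obj PUnit.{u + 1}) : mul T a b = mul T b a := by
  have h1 := congrArg (fmap T fun _ => PUnit.unit.{u + 1})
    ((isCommutative_iff T).1 h PUnit PUnit a b)
  rw [fmap_ext, fmap_ext] at h1
  simp only [fmap_fmap] at h1
  have h2 : ∀ c : T.obj PUnit.{u + 1}, fmap T (fun _ => PUnit.unit) c = c := fun c => fmap_id T c
  simp only [h2] at h1
  rw [mul_eq_ext, mul_eq_ext, h1]

theorem mul_assoc' (a b c : T.obj PUnit.{u + 1}) :
    mul T (mul T a b) c = mul T a (mul T b c) := by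
  simp only [mul_eq_ext, ext_ext]

theorem one_mul' (a : T.obj PUnit.{u + 1}) : mul T (unit T PUnit.unit) a = a := by
  rw [mul_eq_ext, ext_unit]

theorem add_mul' (h : IsAdditive T) (a b c : T.obj PUnit.{u + 1}) :
    mul T (add h a b) c = add h (mul T a c) (mul T b c) := by
  simp only [mul_eq_ext, ext_add]

theorem zero_mul' (h : IsAdditive T) (a : T.obj PUnit.{u + 1}) :
    mul T (zero h PUnit) a = zero h PUnit := by
  rw [mul_eq_ext, ext_zero]

/-- The commutative semiring `T(1)` of a commutative additive monad `T`, with the operations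
`add`, `zero`, `mul` and the unit `η(*)`. -/
@[reducible] noncomputable def commSemiring (hc : IsCommutative T) (h : IsAdditive T) :
    CommSemiring (T.obj PUnit.{u + 1}) where
  add := add h
  zero := zero h PUnit
  mul := mul T
  one := unit T PUnit.unit
  nsmul := @nsmulRec _ ⟨zero h PUnit⟩ ⟨add h⟩
  npow := @npowRec _ ⟨unit T PUnit.unit⟩ ⟨mul T⟩
  add_assoc := add_assoc' h
  zero_add := zero_add' h
  add_zero a := (add_comm' h _ _).trans (zero_add' h a)
  add_comm := add_comm' h
  left_distrib a b c := by
    refine (mul_comm' hc _ _).trans ((add_mul' h _ _ _).trans ?_)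
    rw [mul_comm' hc b a, mul_comm' hc c a]
    rfl
  right_distrib := add_mul' h
  zero_mul := zero_mul' h
  mul_zero a := (mul_comm' hc _ _).trans (zero_mul' h a)
  mul_assoc := mul_assoc'
  one_mul := one_mul'
  mul_one a := (mul_comm' hc _ _).trans (one_mul' a)
  mul_comm := mul_comm' hc

variable {S : Monad (Type u)} (σ : T ⟶ S)

theorem hom_fmap {X Y : Type u} (f : X → Y) (t : T.obj X) :
    σ.app Y (fmap T f t) = fmap S f (σ.app X t) :=
  ConcreteCategory.congr_hom (σ.naturality (↾f)) t

theorem hom_unit {X : Type u} (x : X) : σ.app X (unit T x) = unit S x :=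
  ConcreteCategory.congr_hom (σ.app_η X) x

theorem hom_ext {X Y : Type u} (f : X → T.obj Y) (t : T.obj X) :
    σ.app Y (ext T f t) = ext S (fun x => σ.app Y (f x)) (σ.app X t) := by
  have h1 : σ.app Y (mult T (fmap T f t)) = mult S (σ.app _ (fmap T (σ.app Y) (fmap T f t))) :=
    ConcreteCategory.congr_hom (σ.app_μ Y) _
  unfold ext
  rw [h1, fmap_fmap, hom_fmap]

theorem hom_zero (h : IsAdditive T) (h' : IsAdditive S) (X : Type u) :
    σ.app X (zero h X) = zero h' X :=
  (hom_fmap σ _ _).trans (zeroMap_eq h'.zero _ _ PUnit.unit _).symm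

theorem hom_add (h : IsAdditive T) (h' : IsAdditive S) {X : Type u} (a b : T.obj X) :
    σ.app X (add h a b) = add h' (σ.app X a) (σ.app X b) := by
  obtain ⟨w, ha, hb⟩ := exists_sum h a b
  rw [add_eq h w ha hb, hom_fmap, add_eq h' (σ.app _ w)]
  · rw [← ha, hom_ext]
    refine ext_congr (fun x => ?_) _
    rcases x with x | x <;> simp [hom_unit, hom_zero σ h h']
  · rw [← hb, hom_ext]
    refine ext_congr (fun x => ?_) _
    rcases x with x | x <;> simp [hom_unit, hom_zero σ h h']

theorem hom_mul (a b : T.obj PUnit.{u + 1}) :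
    σ.app _ (mul T a b) = mul S (σ.app _ a) (σ.app _ b) := by
  rw [mul_eq_ext, mul_eq_ext, hom_ext]

end Semiring

/-- The category of commutative additive monads on sets, with monad maps as morphisms. -/
abbrev ACMnd : Type (u + 1) :=
  ObjectProperty.FullSubcategory fun T : Monad (Type u) => IsCommutative T ∧ IsAdditive T

/-- Evaluation at `1`: the functor `T ↦ T(1)`, `σ ↦ σ₁` from commutative additive monads to
commutative semirings. -/
noncomputable def evalFunctor : ACMnd.{u} ⥤ CommSemiRingCat.{u} where
  obj T := @CommSemiRingCat.of (T.obj.obj PUnit.{u + 1}) (commSemiring T.property.1 T.property.2)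
  map {T T'} σ :=
    letI := commSemiring T.property.1 T.property.2
    letI := commSemiring T'.property.1 T'.property.2
    CommSemiRingCat.ofHom
      { toFun := σ.hom.app PUnit.{u + 1}
        map_one' := hom_unit σ.hom PUnit.unit
        map_mul' := hom_mul σ.hom
        map_zero' := hom_zero σ.hom T.property.2 T'.property.2 PUnit
        map_add' := hom_add σ.hom T.property.2 T'.property.2 }
  map_id _ := rfl
  map_comp _ _ := rfl

/-! ### The multiset monads -/

section Multiset

variable (S : Type u) [CommSemiring S]

/-- The multiplication `∑ᵢ sᵢ φᵢ ↦ (x ↦ ∑ᵢ sᵢ φᵢ(x))` of the multiset monad. -/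
noncomputable def multisetMult {X : Type u} (Φ : (X →₀ S) →₀ S) : X →₀ S :=
  Φ.sum fun φ s => s • φ

theorem multisetMult_eq {X : Type u} (Φ : (X →₀ S) →₀ S) :
    multisetMult S Φ = Finsupp.linearCombination S (fun φ : X →₀ S => φ) Φ := rfl

theorem multisetMult_mapDomain {X Y : Type u} (g : X → Y →₀ S) (φ : X →₀ S) :
    multisetMult S (φ.mapDomain g) = Finsupp.linearCombination S g φ := by
  rw [multisetMult_eq, Finsupp.linearCombination_mapDomain]
  rfl

/-- The multiset monad `M_S`: `M_S(X)` is the set of finitely supported functions `X → S`,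
`M_S(f)(φ)(y) = ∑_{f(x) = y} φ(x)`, `η(x) = 1 x` and
`μ(∑ᵢ sᵢ φᵢ) = (x ↦ ∑ᵢ sᵢ φᵢ(x))`. -/
noncomputable def multisetMonad : Monad (Type u) where
  obj X := X →₀ S
  map f := ↾(Finsupp.mapDomain (M := S) f)
  map_id X := by ext φ : 3; exact Finsupp.mapDomain_id (M := S)
  map_comp f g := by
    ext φ : 3
    exact Finsupp.mapDomain_comp (M := S) (f := f) (g := g)
  η := { app := fun X => ↾(fun x : X => Finsupp.single x (1 : S))
         naturality := fun X Y f => by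
          ext x : 3
          exact (Finsupp.mapDomain_single (M := S)).symm }
  μ := { app := fun X => ↾(multisetMult S (X := X))
         naturality := fun X Y f => by
          ext Φ : 3
          change multisetMult S (Finsupp.mapDomain (Finsupp.mapDomain f) Φ) =
            Finsupp.mapDomain f (multisetMult S Φ)
          induction Φ using Finsupp.induction_linear with
          | zero => simp [multisetMult]
          | add a b ha hb =>
            simp only [multisetMult_eq, Finsupp.mapDomain_add, map_add] at *
            rw [ha, hb]
          | single φ s =>
            simp [multisetMult_eq, Finsupp.mapDomain_single, Finsupp.mapDomain_smul] }
  assoc X := by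
    ext Φ : 3
    change multisetMult S (Finsupp.mapDomain (multisetMult S) Φ) =
      multisetMult S (multisetMult S Φ)
    induction Φ using Finsupp.induction_linear with
    | zero => simp [multisetMult]
    | add a b ha hb =>
      simp only [multisetMult_eq, Finsupp.mapDomain_add, map_add] at *
      rw [ha, hb]
    | single φ s => simp [multisetMult_eq, Finsupp.mapDomain_single]
  left_unit X := by
    ext φ : 3
    change multisetMult S (Finsupp.single φ 1) = φ
    simp [multisetMult_eq]
  right_unit X := by
    ext φ : 3
    change multisetMult S (Finsupp.mapDomain (fun x => Finsupp.single x 1) φ) = φ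
    rw [multisetMult_mapDomain, Finsupp.linearCombination_apply]
    simp

theorem multiset_ext {X Y : Type u} (f : X → Y →₀ S) (φ : X →₀ S) :
    ext (multisetMonad S) f φ = Finsupp.linearCombination S f φ :=
  multisetMult_mapDomain S f φ

theorem multiset_isCommutative : IsCommutative (multisetMonad S) := by
  rw [isCommutative_iff]
  intro X Y (a : X →₀ S) (b : Y →₀ S)
  refine (multiset_ext S _ _).trans (Eq.trans ?_ (multiset_ext S _ _).symm)
  change Finsupp.linearCombination S (fun x => Finsupp.mapDomain (fun y => (x, y)) b) a =
    Finsupp.linearCombination S (fun y => Finsupp.mapDomain (fun x => (x, y)) a) b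
  simp only [Finsupp.linearCombination_apply, Finsupp.mapDomain, Finsupp.smul_sum,
    Finsupp.smul_single, smul_eq_mul]
  rw [Finsupp.sum_comm]
  simp only [mul_comm]

theorem multiset_zeroTerminal : ZeroTerminal (multisetMonad S) := by
  refine ⟨Equiv.toIso ?_⟩
  exact (Equiv.equivPUnit (PEmpty.{u + 1} →₀ S))

theorem multiset_zeroMap (h : ZeroTerminal (multisetMonad S)) (X Y : Type u) (x : X) :
    zeroMap h X Y x = (0 : Y →₀ S) :=
  (zeroMap_eq h X Y x (0 : PEmpty.{u + 1} →₀ S)).trans (Finsupp.mapDomain_zero (M := S) (f := (PEmpty.elim : PEmpty.{u + 1} → Y)))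

theorem linearCombination_apply_of {X Z : Type u} (p : Z → X →₀ S) (k : X → Z)
    (hp : ∀ z x, p z x = Finsupp.single z (1 : S) (k x)) (χ : Z →₀ S) (x : X) :
    Finsupp.linearCombination S p χ x = χ (k x) := by
  induction χ using Finsupp.induction_linear with
  | zero => simp
  | add a b ha hb => rw [map_add, Finsupp.add_apply, Finsupp.add_apply, ha, hb]
  | single z s =>
    classical
    rw [Finsupp.linearCombination_single, Finsupp.smul_apply, hp]
    simp [Finsupp.single_apply]

/-- For the multiset monad, `bc` is the map `χ ↦ (χ ∘ κ₁, χ ∘ κ₂)`. -/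
theorem multiset_bc (h : ZeroTerminal (multisetMonad S)) (X Y : Type u) (χ : X ⊕ Y →₀ S) :
    bc h X Y χ = (Finsupp.sumFinsuppEquivProdFinsupp χ : (X →₀ S) × (Y →₀ S)) := by
  classical
  refine Prod.ext ?_ ?_
  · refine (multiset_ext S _ _).trans (Finsupp.ext fun x => ?_)
    rw [Finsupp.fst_sumFinsuppEquivProdFinsupp]
    refine linearCombination_apply_of S _ _ (fun z x => ?_) χ x
    rcases z with z | z
    · change Finsupp.single z (1 : S) x = _
      simp [Finsupp.single_apply]
    · rw [show proj₁ h X Y (Sum.inr z) = (0 : X →₀ S) from multiset_zeroMap S h Y X z]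
      simp
  · refine (multiset_ext S _ _).trans (Finsupp.ext fun x => ?_)
    rw [Finsupp.snd_sumFinsuppEquivProdFinsupp]
    refine linearCombination_apply_of S _ _ (fun z x => ?_) χ x
    rcases z with z | z
    · rw [show proj₂ h X Y (Sum.inl z) = (0 : Y →₀ S) from multiset_zeroMap S h X Y z]
      simp
    · change Finsupp.single z (1 : S) x = _
      simp [Finsupp.single_apply]

theorem multiset_isAdditive : IsAdditive (multisetMonad S) where
  zero := multiset_zeroTerminal S
  bc_bijective X Y := by
    rw [show bc (multiset_zeroTerminal S) X Y = Finsupp.sumFinsuppEquivProdFinsupp from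
      funext (multiset_bc S _ X Y)]
    exact Equiv.bijective _

variable {S} {R : Type u} [CommSemiring R]

theorem mapRange_multisetMult (f : S →+* R) {X : Type u} (Φ : (X →₀ S) →₀ S) :
    Finsupp.mapRange f (map_zero f) (multisetMult S Φ) =
      multisetMult R (Finsupp.mapRange f (map_zero f)
        (Finsupp.mapDomain (Finsupp.mapRange f (map_zero f)) Φ)) := by
  induction Φ using Finsupp.induction_linear with
  | zero => simp [multisetMult]
  | add a b ha hb =>
    simp only [multisetMult_eq, Finsupp.mapDomain_add, map_add,
      Finsupp.mapRange_add (map_add f)] at *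
    rw [ha, hb]
  | single φ s =>
    ext x
    simp [multisetMult_eq, Finsupp.mapDomain_single]

/-- The monad map `M_S → M_R`, `∑ᵢ sᵢ xᵢ ↦ ∑ᵢ f(sᵢ) xᵢ` induced by a semiring map `f`. -/
noncomputable def multisetMonadMap (f : S →+* R) : multisetMonad S ⟶ multisetMonad R :=
  { app := fun X => ↾(Finsupp.mapRange (α := X) f (map_zero f))
    naturality := fun X Y g => by
      ext φ : 3
      exact (Finsupp.mapDomain_mapRange g φ f (map_zero f) (map_add f)).symm
    app_η := fun X => by
      ext x : 3
      change Finsupp.mapRange f (map_zero f) (Finsupp.single x (1 : S)) = Finsupp.single x (1 : R)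
      simp
    app_μ := fun X => by
      ext Φ : 3
      exact mapRange_multisetMult f Φ : MonadHom _ _ }

end Multiset

/-- The functor `S ↦ M_S` from commutative semirings to commutative additive monads. -/
noncomputable def multisetFunctor : CommSemiRingCat.{u} ⥤ ACMnd.{u} where
  obj S := ⟨multisetMonad S, multiset_isCommutative S, multiset_isAdditive S⟩
  map f := ObjectProperty.homMk (multisetMonadMap f.hom)
  map_id S := by
    apply ObjectProperty.hom_ext
    apply MonadHom.ext
    funext X
    ext φ : 3
    exact Finsupp.mapRange_id φ
  map_comp f g := by
    apply ObjectProperty.hom_ext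
    apply MonadHom.ext
    funext X
    ext φ : 3
    exact Finsupp.mapRange_comp g.hom (map_zero g.hom) f.hom (map_zero f.hom) (by simp) φ

end SetMonad

namespace SetMonad

open Finsupp

/-! ### The sets `T(X)` as modules over the semiring `T(1)` -/

section Module

/-! Additivity makes every `T(X)` a commutative monoid, and commutativity makes Kleisli extension
over the point an action of the semiring `T(1)` on it, so `T(X)` is a `T(1)`-module and every
Kleisli extension is `T(1)`-linear. As a set, `M_{T(1)}(X)` is the free `T(1)`-module on `X`, so `η`
extends to a unique linear map `evalSum : M_{T(1)}(X) → T(X)`. These maps form the counit. They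
respect `μ` because a linear map commutes with linear combinations (`ext_evalSum`), and they are
natural in `T` because monad maps preserve sums, zero and `T(f)` (`evalSum_mapRange`).

The unit is the inverse of evaluation at the point, `M_S(1) ≅ S`; that this is an isomorphism of
semirings rests on computing the abstract operations of `M_S` (`multiset_add`, `multiset_mul`). One
triangle identity says that a formal sum over `S` is the sum of its own terms; the other says that
`T(id)` fixes `s ∈ T(1)`. Since the unit is invertible, the left adjoint is full and faithful. -/

noncomputable instance (T : ACMnd.{u}) : CommSemiring (T.obj.obj PUnit.{u + 1}) :=
  commSemiring T.property.1 T.property.2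

variable (T : ACMnd.{u}) (X : Type u)

/-- The commutative monoid structure on `T(X)` given by `add` and `zero`. -/
@[reducible] noncomputable def addCommMonoid : AddCommMonoid (T.obj.obj X) where
  add := add T.property.2
  zero := zero T.property.2 X
  nsmul := @nsmulRec _ ⟨zero T.property.2 X⟩ ⟨add T.property.2⟩
  add_assoc := add_assoc' T.property.2
  zero_add := zero_add' T.property.2
  add_zero a := (add_comm' T.property.2 _ _).trans (zero_add' T.property.2 a)
  add_comm := add_comm' T.property.2

attribute [local instance] addCommMonoid

/-- Commutativity for the pair `1`, `X`, projected to `X`. The right side is a Kleisli extension in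
`t`, hence additive in `t`; this gives distributivity of the action over sums in `T(X)`, the one
module axiom where commutativity enters. -/
theorem ext_const_comm {T : Monad (Type u)} (hc : IsCommutative T) {X : Type u}
    (s : T.obj PUnit.{u + 1}) (t : T.obj X) :
    ext T (fun _ => t) s = ext T (fun x => fmap T (fun _ => x) s) t := by
  have h := congrArg (fmap T Prod.snd) ((isCommutative_iff T).1 hc PUnit X s t)
  simpa only [fmap_ext, fmap_fmap, fmap_id] using h

/-- The action `s • t = μ(T(* ↦ t)(s))` of `T(1)` on `T(X)`. -/
@[reducible] noncomputable def module : Module (T.obj.obj PUnit.{u + 1}) (T.obj.obj X) where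
  smul s t := ext T.obj (fun _ => t) s
  one_smul t := ext_unit T.obj (fun _ => t) PUnit.unit
  mul_smul a b t := by
    change ext T.obj (fun _ => t) (mul T.obj a b) =
      ext T.obj (fun _ => ext T.obj (fun _ => t) b) a
    rw [mul_eq_ext, ext_ext]
  smul_zero s := ext_zero_fun T.property.2 s
  smul_add s a b := by
    change ext T.obj (fun _ => add T.property.2 a b) s =
      add T.property.2 (ext T.obj (fun _ => a) s) (ext T.obj (fun _ => b) s)
    simp only [ext_const_comm T.property.1 s, ext_add]
  add_smul a b t := ext_add T.property.2 (fun _ => t) a b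
  zero_smul t := ext_zero T.property.2 (fun _ => t)

attribute [local instance] module

variable {T X} {Y : Type u}

/-- Kleisli extension as a `T(1)`-linear map. -/
noncomputable def extLinear (f : X → T.obj.obj Y) :
    T.obj.obj X →ₗ[T.obj.obj PUnit.{u + 1}] T.obj.obj Y where
  toFun := ext T.obj f
  map_add' := ext_add T.property.2 f
  map_smul' s t := ext_ext T.obj f (fun _ => t) s

/-- The `T(1)`-linear map `∑ᵢ sᵢ xᵢ ↦ ∑ᵢ sᵢ • η(xᵢ)` from `M_{T(1)}(X)` to `T(X)`. -/
noncomputable def evalSum (T : ACMnd.{u}) (X : Type u) :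
    (X →₀ T.obj.obj PUnit.{u + 1}) →ₗ[T.obj.obj PUnit.{u + 1}] T.obj.obj X :=
  Finsupp.linearCombination _ (unit T.obj)

/-- `extLinear f` is linear and agrees with `f` on units, so composing it with `evalSum` gives the
linear extension of `f`. Compatibility of the counit with `T(f)` and `μ` reduces to this. -/
theorem ext_evalSum (f : X → T.obj.obj Y) (φ : X →₀ T.obj.obj PUnit.{u + 1}) :
    ext T.obj f (evalSum T X φ) = Finsupp.linearCombination (T.obj.obj PUnit.{u + 1}) f φ := by
  have h := Finsupp.apply_linearCombination (T.obj.obj PUnit.{u + 1}) (extLinear f)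
    (unit T.obj) φ
  refine h.trans ?_
  rw [show (extLinear f ∘ unit T.obj) = f from funext (ext_unit T.obj f)]

theorem evalSum_mapDomain (f : X → Y) (φ : X →₀ T.obj.obj PUnit.{u + 1}) :
    evalSum T Y (mapDomain f φ) = fmap T.obj f (evalSum T X φ) := by
  rw [fmap_eq_ext, ext_evalSum]
  exact Finsupp.linearCombination_mapDomain _ _ _

theorem evalSum_unit (x : X) : evalSum T X (single x 1) = unit T.obj x := by
  simp [evalSum]

/-- `s • η(x)` is the Kleisli extension of a constant map factoring through `η`. In the form `T(* ↦
x)(s)` it is visibly preserved by monad maps, so later identities can be checked on single terms. -/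
theorem evalSum_single (x : X) (s : T.obj.obj PUnit.{u + 1}) :
    evalSum T X (single x s) = fmap T.obj (fun _ => x) s := by
  rw [fmap_eq_ext]
  exact Finsupp.linearCombination_single _ _ _

/-- Linearity expressed through the monad's own `add` and `zero`, usable where the local module
instances are not in scope. -/
theorem evalSum_add (φ ψ : X →₀ T.obj.obj PUnit.{u + 1}) :
    evalSum T X (φ + ψ) = add T.property.2 (evalSum T X φ) (evalSum T X ψ) :=
  map_add (evalSum T X) φ ψ

theorem evalSum_zero : evalSum T X 0 = zero T.property.2 X :=
  map_zero (evalSum T X)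

/-- Writing `μ` as the Kleisli extension of the identity turns both sides into the linear
combination of the elements `evalSum φ` with coefficients `Φ`. -/
theorem evalSum_multisetMult (Φ : (X →₀ T.obj.obj PUnit.{u + 1}) →₀ T.obj.obj PUnit.{u + 1}) :
    evalSum T X (multisetMult _ Φ) =
      mult T.obj (evalSum T (T.obj.obj X) (mapDomain (evalSum T X) Φ)) := by
  have h : ∀ t : T.obj.obj (T.obj.obj X), mult T.obj t = ext T.obj (fun x => x) t := fun t => by
    rw [ext, fmap_id]
  rw [h, ext_evalSum, Finsupp.linearCombination_mapDomain, multisetMult_eq,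
    Finsupp.apply_linearCombination]
  rfl

end Module

/-! ### The counit -/

/-- The monad map `M_{T(1)} → T`, `∑ᵢ sᵢ xᵢ ↦ ∑ᵢ sᵢ • η(xᵢ)`. -/
noncomputable def counitMap (T : ACMnd.{u}) :
    multisetMonad (T.obj.obj PUnit.{u + 1}) ⟶ T.obj :=
  { app := fun X => ↾(evalSum T X)
    naturality := fun X Y f => by
      ext φ : 3
      exact evalSum_mapDomain f φ
    app_η := fun X => by
      ext x : 3
      exact evalSum_unit x
    app_μ := fun X => by
      ext Φ : 3
      exact evalSum_multisetMult Φ : MonadHom _ _ }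

theorem evalSum_mapRange {T T' : ACMnd.{u}} (σ : T ⟶ T')
    (f : T.obj.obj PUnit.{u + 1} →+* T'.obj.obj PUnit.{u + 1})
    (hf : ∀ s, f s = σ.hom.app PUnit.{u + 1} s) (X : Type u)
    (φ : X →₀ T.obj.obj PUnit.{u + 1}) :
    evalSum T' X (mapRange f (map_zero f) φ) = σ.hom.app X (evalSum T X φ) := by
  induction φ using Finsupp.induction_linear with
  | zero =>
    rw [mapRange_zero, evalSum_zero, evalSum_zero]
    exact (hom_zero σ.hom T.property.2 T'.property.2 X).symm
  | add a b ha hb =>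
    rw [mapRange_add (map_add f), evalSum_add, evalSum_add, ha, hb]
    exact (hom_add σ.hom T.property.2 T'.property.2 _ _).symm
  | single x s =>
    rw [mapRange_single, evalSum_single, evalSum_single, hf]
    exact (hom_fmap σ.hom _ s).symm

/-- The natural transformation with components the monad maps `M_{T(1)} → T`. -/
noncomputable def counit : evalFunctor.{u} ⋙ multisetFunctor.{u} ⟶ 𝟭 ACMnd.{u} where
  app T := ObjectProperty.homMk (counitMap T)
  naturality T T' σ := by
    apply ObjectProperty.hom_ext
    apply MonadHom.ext
    funext X
    ext φ : 3
    exact evalSum_mapRange σ (evalFunctor.map σ).hom (fun _ => rfl) X φ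

/-! ### Evaluation at the point -/

section Eval

variable (S : Type u) [CommSemiring S]

theorem multiset_zero (h : IsAdditive (multisetMonad S)) (X : Type u) :
    zero h X = (0 : X →₀ S) :=
  multiset_zeroMap S h.zero _ X PUnit.unit

/-- `bc` is explicit for `M_S`, so its preimage of `(a, b)` is the function on `X + X` that is `a`
on the left and `b` on the right; pushing it along the codiagonal adds the two. -/
theorem multiset_add (h : IsAdditive (multisetMonad S)) {X : Type u} (a b : X →₀ S) :
    add (T := multisetMonad S) h a b = (a + b : X →₀ S) := by
  have hw := multiset_bc S h.zero X X (sumFinsuppEquivProdFinsupp.symm (a, b))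
  rw [Equiv.apply_symm_apply] at hw
  refine (add_eq h _ (congrArg Prod.fst hw) (congrArg Prod.snd hw)).trans ?_
  change mapDomain (Sum.elim id id) (sumFinsuppEquivProdFinsupp.symm (a, b)) = a + b
  -- Split as a sum of two pushforwards, each of which the codiagonal sends back to its summand.
  have h2 : sumFinsuppEquivProdFinsupp.symm (a, b) =
      mapDomain Sum.inl a + mapDomain Sum.inr b := by
    rw [Equiv.symm_apply_eq]
    refine Prod.ext (Finsupp.ext fun x => ?_) (Finsupp.ext fun x => ?_)
    · simp [mapDomain_apply Sum.inl_injective,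
        mapDomain_of_notMem_range]
    · simp [mapDomain_apply Sum.inr_injective,
        mapDomain_of_notMem_range]
  rw [h2, mapDomain_add, ← mapDomain_comp, ← mapDomain_comp]
  simp [mapDomain_id]

theorem linearCombination_const_punit {X : Type u} (a : PUnit.{u + 1} →₀ S) (b : X →₀ S) :
    Finsupp.linearCombination S (fun _ => b) a = a PUnit.unit • b := by
  rw [linearCombination_apply, Finsupp.sum_fintype _ _ (by simp)]
  simp

theorem multiset_mul (a b : PUnit.{u + 1} →₀ S) :
    mul (multisetMonad S) a b = (a PUnit.unit • b : PUnit.{u + 1} →₀ S) :=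
  (mul_eq_ext (multisetMonad S) a b).trans
    ((multiset_ext S _ _).trans (linearCombination_const_punit S a b))

end Eval

/-- Evaluation at the point, as a bijection between `M_S(1)` and `S`. -/
noncomputable def evalPointEquiv (S : Type u) [CommSemiring S] : (PUnit.{u + 1} →₀ S) ≃ S where
  toFun φ := φ PUnit.unit
  invFun s := single PUnit.unit s
  left_inv φ := (Finsupp.unique_single φ).symm
  right_inv _ := single_eq_same

/-- Evaluation at the point, as an isomorphism of semirings `M_S(1) ≅ S`. -/
noncomputable def evalPoint (S : CommSemiRingCat.{u}) :
    (multisetFunctor.{u}.obj S).obj.obj PUnit.{u + 1} ≃+* S where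
  toEquiv := evalPointEquiv S
  map_mul' a b := congrArg (evalPointEquiv S) (multiset_mul S a b)
  map_add' a b := congrArg (evalPointEquiv S) (multiset_add S (multiset_isAdditive S) a b)

/-- The natural isomorphism `M_S(1) ≅ S`. -/
noncomputable def evalPointIso :
    multisetFunctor.{u} ⋙ evalFunctor.{u} ≅ 𝟭 CommSemiRingCat.{u} :=
  NatIso.ofComponents (fun S => (evalPoint S).toCommSemiRingCatIso) fun _ => by
    ext φ
    rfl

/-- The first triangle identity at `X`. By additivity only a single term `s x` matters: it is sent
to `s` placed at the point, then moved to `x` by `M_S(* ↦ x)`. -/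
theorem evalSum_multiset (S : CommSemiRingCat.{u}) (X : Type u) (φ : X →₀ S) :
    evalSum (multisetFunctor.obj S) X
      (mapRange (evalPoint S).symm (map_zero (evalPoint S).symm) φ) = φ := by
  induction φ using Finsupp.induction_linear with
  | zero =>
    rw [mapRange_zero, evalSum_zero]
    exact multiset_zero S (multiset_isAdditive S) X
  | add a b ha hb =>
    rw [mapRange_add (map_add (evalPoint S).symm), evalSum_add, ha, hb]
    exact multiset_add S (multiset_isAdditive S) a b
  | single x s =>
    rw [mapRange_single, evalSum_single]
    exact mapDomain_single (M := S)

/-! ### The adjunction and full faithfulness -/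

/-- The adjunction between the multiset functor and evaluation at `1`. -/
noncomputable def multisetAdjunction : multisetFunctor.{u} ⊣ evalFunctor.{u} where
  unit := evalPointIso.inv
  counit := counit
  left_triangle_components S := by
    apply ObjectProperty.hom_ext
    apply MonadHom.ext
    funext X
    ext φ : 3
    exact evalSum_multiset S X φ
  right_triangle_components T := by
    ext s
    exact (evalSum_single PUnit.unit s).trans (fmap_id T.obj s)

end SetMonad

theorem mainTheorem2 :
    ∃ (adj : SetMonad.multisetFunctor.{u} ⊣ SetMonad.evalFunctor.{u})
      (ev : SetMonad.multisetFunctor.{u} ⋙ SetMonad.evalFunctor.{u} ≅ 𝟭 CommSemiRingCat.{u}),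
      (∀ (S : CommSemiRingCat.{u}) (φ : PUnit.{u + 1} →₀ S),
        (ev.hom.app S).hom φ = φ PUnit.unit) ∧
      adj.unit = ev.inv ∧
      SetMonad.multisetFunctor.{u}.Full ∧ SetMonad.multisetFunctor.{u}.Faithful := by
  -- The unit is by definition the inverse of evaluation at the point, and a left adjoint with
  -- invertible unit is fully faithful.
  have : IsIso SetMonad.multisetAdjunction.{u}.unit :=
    inferInstanceAs (IsIso SetMonad.evalPointIso.inv)
  have ff := SetMonad.multisetAdjunction.{u}.fullyFaithfulLOfIsIsoUnit
  exact ⟨SetMonad.multisetAdjunction, SetMonad.evalPointIso, fun _ _ => rfl, rfl,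
    ff.full, ff.faithful⟩
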